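/- Let $(M,d)$ be a complete metric space with a distinguished base point $0\in M$. Let $\mathrm{Lip}_0(M)$ be the Banach space of complex-valued Lipschitz functions on $M$ vanishing at $0$, normed by the best Lipschitz constant; for $x\in M$ let $\delta(x)\in \mathrm{Lip}_0(M)^*$ be the evaluation at $x$, and let $\mathcal F(M)=\overline{\mathrm{span}}\,\{\delta(x):x\in M\}\subset \mathrm{Lip}_0(M)^*$ be the Lipschitz-free space over $M$. For $N\subset M$ put $\mathcal F_M(N)=\overline{\mathrm{span}}\,\{\delta(x):x\in N\}$; the support of $\gamma\in\mathcal F(M)$ is the smallest closed set $N\subset M$ such that $\gamma\in\mathcal F_M(N)$. Let $f:M\to M$ and $w:M\to\mathbb C$ be maps such that $$\sum_{i} a_i\delta(x_i)\longmapsto \sum_{i} a_i\,w(x_i)\,\delta(f(x_i))$$ is a well-defined continuous linear map from $\mathrm{span}\,\delta(M)$ to $\mathcal F(M)$, and let $w\widehat f:\mathcal F(M)\to\mathcal F(M)$ be its bounded linear extension (written $\widehat f$ when $w\equiv 1$). Write $\sigma_p(T)$ for the set of eigenvalues of a bounded operator $T$. For $n\ge 1$ let $\mathrm{Per}_n(f)$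 be the set of points $x\in M\setminus\{0\}$ with $f^n(x)=x$ and $f^k(x)\ne x$ for $1\le k\le n-1$, let $A=\{n\ge 1: \mathrm{Per}_n(f)\neq\emptyset\}$, and let $\mathbb U_n=\{z\in\mathbb C: z^n=1\}$. Theorem. Assume that $f(M)$ is totally bounded and that there are $r>0$ and $\varepsilon\in(0,1)$ such that $f$ is $(r,\varepsilon)$-flat, i.e. $\frac{d(f(x),f(y))}{d(x,y)}\le\varepsilon$ for all $x\ne y$ in $M$ with $d(x,y)\le r$. Then every eigenvector of $w\widehat f$ associated with a nonzero eigenvalue has finite support, and $$\sigma_p(w\widehat f)\setminus\{0\}=\bigcup_{n\in A}\Big\{\lambda\in\mathbb C\setminus\{0\}:\ \exists x\in \mathrm{Per}_n(f),\ \lambda^n=\prod_{i=1}^n w\big(f^i(x)\big)\Big\}.$$ In particular, if $w\equiv 1$, then $\sigma_p(\widehat f)\setminus\{0\}=\bigcup_{n\in A}\mathbb U_n$. -/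

import Mathlib

namespace LipFree

section Lip0

variable {M : Type*} [MetricSpace M]

/-- The vector space of complex-valued Lipschitz functions on `M` vanishing at the base point. -/
def lip0Submodule (o : M) : Submodule ℂ (M → ℂ) where
  carrier := {g | g o = 0 ∧ ∃ K : NNReal, LipschitzWith K g}
  zero_mem' := ⟨rfl, 0, LipschitzWith.const 0⟩
  add_mem' := by
    rintro g h ⟨hg, K, hK⟩ ⟨hh, L, hL⟩
    exact ⟨by simp [hg, hh], K + L, hK.add hL⟩
  smul_mem' := by
    rintro c g ⟨hg, K, hK⟩
    exact ⟨by simp [hg], ‖c‖₊ * K, (lipschitzWith_smul c).comp hK⟩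

/-- The space `Lip₀(M)`, where `o` is the base point of `M`. -/
def Lip0 (o : M) : Type _ := ↥(lip0Submodule o)

variable {o : M}

instance : CoeFun (Lip0 o) (fun _ => M → ℂ) := ⟨fun g => g.1⟩

instance : AddCommGroup (Lip0 o) := inferInstanceAs (AddCommGroup ↥(lip0Submodule o))

instance : Module ℂ (Lip0 o) := inferInstanceAs (Module ℂ ↥(lip0Submodule o))

/-- The Lipschitz norm: the supremum of the difference quotients (the pairs on the diagonal
contribute `0 / 0 = 0`). -/
noncomputable instance : Norm (Lip0 o) :=
  ⟨fun g => ⨆ p : M × M, ‖g p.1 - g p.2‖ / dist p.1 p.2⟩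

@[simp] theorem Lip0.add_apply (g h : Lip0 o) (x : M) : (g + h) x = g x + h x := rfl

@[simp] theorem Lip0.neg_apply (g : Lip0 o) (x : M) : (-g) x = -g x := rfl

@[simp] theorem Lip0.smul_apply (c : ℂ) (g : Lip0 o) (x : M) : (c • g) x = c * g x := rfl

theorem Lip0.base (g : Lip0 o) : g o = 0 := g.2.1

theorem Lip0.norm_def (g : Lip0 o) :
    ‖g‖ = ⨆ p : M × M, ‖g p.1 - g p.2‖ / dist p.1 p.2 := rfl

theorem Lip0.bddAbove (g : Lip0 o) :
    BddAbove (Set.range fun p : M × M => ‖g p.1 - g p.2‖ / dist p.1 p.2) := by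
  obtain ⟨K, hK⟩ := g.2.2
  refine ⟨K, ?_⟩
  rintro _ ⟨p, rfl⟩
  refine div_le_of_le_mul₀ dist_nonneg K.2 ?_
  have h := hK.dist_le_mul p.1 p.2
  rwa [dist_eq_norm] at h

theorem Lip0.norm_nonneg' (g : Lip0 o) : 0 ≤ ‖g‖ :=
  Real.iSup_nonneg fun _ => div_nonneg (norm_nonneg _) dist_nonneg

theorem Lip0.norm_sub_le (g : Lip0 o) (x y : M) : ‖g x - g y‖ ≤ ‖g‖ * dist x y := by
  rcases eq_or_ne x y with rfl | hxy
  · simp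
  · exact (div_le_iff₀ (dist_pos.2 hxy)).1 (le_ciSup g.bddAbove (x, y))

theorem Lip0.norm_le_of {g : Lip0 o} {K : ℝ} (hK : 0 ≤ K)
    (h : ∀ x y, ‖g x - g y‖ ≤ K * dist x y) : ‖g‖ ≤ K :=
  Real.iSup_le (fun p => div_le_of_le_mul₀ dist_nonneg hK (h p.1 p.2)) hK

noncomputable instance : NormedAddCommGroup (Lip0 o) :=
  AddGroupNorm.toNormedAddCommGroup
    { toFun := norm
      map_zero' := by
        refine le_antisymm (Lip0.norm_le_of le_rfl fun x y => ?_) (Lip0.norm_nonneg' _)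
        change ‖(0 : ℂ) - 0‖ ≤ _
        simp
      add_le' := fun g h => by
        refine Lip0.norm_le_of (add_nonneg g.norm_nonneg' h.norm_nonneg') fun x y => ?_
        rw [Lip0.add_apply, Lip0.add_apply, add_sub_add_comm, add_mul]
        exact (norm_add_le _ _).trans (add_le_add (g.norm_sub_le x y) (h.norm_sub_le x y))
      neg' := fun g => by
        simp only [Lip0.norm_def, Lip0.neg_apply, neg_sub_neg]
        simp only [norm_sub_rev]
      eq_zero_of_map_eq_zero' := fun g h0 => by
        refine Subtype.ext (funext fun x => ?_)
        have h := g.norm_sub_le x o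
        rw [show ‖g‖ = 0 from h0, zero_mul, g.base, sub_zero] at h
        exact norm_le_zero_iff.1 h }

noncomputable instance : NormedSpace ℂ (Lip0 o) where
  norm_smul_le c g := by
    refine Lip0.norm_le_of (mul_nonneg (norm_nonneg c) g.norm_nonneg') fun x y => ?_
    rw [Lip0.smul_apply, Lip0.smul_apply, ← mul_sub, norm_mul, mul_assoc]
    exact mul_le_mul_of_nonneg_left (g.norm_sub_le x y) (norm_nonneg c)

end Lip0

section FreeSpace

variable {M : Type*} [MetricSpace M]

/-- The evaluation functional at `x`, as an element of the dual of `Lip₀(M)`. -/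
noncomputable def evalDual (o x : M) : StrongDual ℂ (Lip0 o) :=
  LinearMap.mkContinuous
    { toFun := fun g : Lip0 o => g x
      map_add' := fun _ _ => rfl
      map_smul' := fun _ _ => rfl }
    (dist x o) (fun g => by
      have h := g.norm_sub_le x o
      rw [g.base, sub_zero, mul_comm] at h
      exact h)

/-- The Lipschitz-free space `F(M)`: the closed linear span of the evaluation functionals in the
dual of `Lip₀(M)`. -/
noncomputable def freeSubmodule (o : M) : Submodule ℂ (StrongDual ℂ (Lip0 o)) :=
  (Submodule.span ℂ (Set.range (evalDual o))).topologicalClosure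

/-- The Lipschitz-free space `F(M)` as a normed space, where `o` is the base point of `M`. -/
def FreeSpace (o : M) : Type _ := ↥(freeSubmodule o)

noncomputable instance (o : M) : NormedAddCommGroup (FreeSpace o) :=
  inferInstanceAs (NormedAddCommGroup ↥(freeSubmodule o))

noncomputable instance (o : M) : NormedSpace ℂ (FreeSpace o) :=
  inferInstanceAs (NormedSpace ℂ ↥(freeSubmodule o))

/-- The isometric inclusion of `F(M)` into the dual of `Lip₀(M)`. -/
noncomputable def FreeSpace.toDual (o : M) : FreeSpace o →ₗᵢ[ℂ] StrongDual ℂ (Lip0 o) :=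
  (freeSubmodule o).subtypeₗᵢ

instance (o : M) : CompleteSpace (FreeSpace o) :=
  inferInstanceAs (CompleteSpace ↥((Submodule.span ℂ (Set.range (evalDual o))).topologicalClosure))

/-- The canonical map `δ : M → F(M)`. -/
noncomputable def delta (o x : M) : FreeSpace o :=
  ⟨evalDual o x, Submodule.le_topologicalClosure _ (Submodule.subset_span ⟨x, rfl⟩)⟩

/-- The closed subspace `F_M(N)` of `F(M)`, the closed linear span of `δ(N)`. -/
noncomputable def freeOn (o : M) (N : Set M) : Submodule ℂ (FreeSpace o) :=
  (Submodule.span ℂ (delta o '' N)).topologicalClosure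

/-- `S` is the support of `γ`: the smallest closed subset `N` of `M` with `γ ∈ F_M(N)`. -/
def IsSupport (o : M) (γ : FreeSpace o) (S : Set M) : Prop :=
  IsLeast {N : Set M | IsClosed N ∧ γ ∈ freeOn o N} S

/-- The formal sum `∑ aᵢ xᵢ` is sent to `∑ aᵢ δ(xᵢ)`. -/
noncomputable def deltaSum (o : M) : (M →₀ ℂ) →ₗ[ℂ] FreeSpace o :=
  Finsupp.linearCombination ℂ (delta o)

/-- The formal sum `∑ aᵢ xᵢ` is sent to `∑ aᵢ w(xᵢ) δ(f(xᵢ))`. -/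
noncomputable def weightedSum (o : M) (w : M → ℂ) (f : M → M) : (M →₀ ℂ) →ₗ[ℂ] FreeSpace o :=
  Finsupp.linearCombination ℂ (fun x => w x • delta o (f x))

/-- The formula `∑ aᵢ δ(xᵢ) ↦ ∑ aᵢ w(xᵢ) δ(f(xᵢ))` is a well-defined and continuous linear map
from the linear span of `δ(M)` to `F(M)`. -/
def IsBoundedWeighted (o : M) (w : M → ℂ) (f : M → M) : Prop :=
  ∃ C : ℝ, ∀ a : M →₀ ℂ, ‖weightedSum o w f a‖ ≤ C * ‖deltaSum o a‖

/-- The weighted Lipschitz operator `w f̂ : F(M) → F(M)`: the continuous linear extension of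
`∑ aᵢ δ(xᵢ) ↦ ∑ aᵢ w(xᵢ) δ(f(xᵢ))`. It is meaningful when `IsBoundedWeighted o w f` holds. -/
noncomputable def weightedLipschitz (o : M) (w : M → ℂ) (f : M → M) :
    FreeSpace o →L[ℂ] FreeSpace o :=
  (weightedSum o w f).extendOfNorm (deltaSum o)

@[simp] theorem FreeSpace.toDual_delta (o x : M) (g : Lip0 o) :
    FreeSpace.toDual o (delta o x) g = g x := rfl

theorem denseRange_deltaSum (o : M) : DenseRange (deltaSum o) := by
  have hr : Set.range (FreeSpace.toDual o ∘ deltaSum o)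
      = (Submodule.span ℂ (Set.range (evalDual o)) : Set (StrongDual ℂ (Lip0 o))) := by
    rw [← Finsupp.range_linearCombination]
    ext φ
    simp only [Set.mem_range, SetLike.mem_coe, LinearMap.mem_range, Function.comp]
    refine exists_congr fun a => ?_
    rw [deltaSum, Finsupp.linearCombination_apply, Finsupp.linearCombination_apply,
      map_finsuppSum]
    simp only [map_smul]
    rfl
  intro γ
  rw [(FreeSpace.toDual o).isometry.isEmbedding.isInducing.closure_eq_preimage_closure_image,
    ← Set.range_comp, hr]
  exact γ.2

/-- On finite sums the weighted Lipschitz operator is given by the expected formula. -/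
theorem weightedLipschitz_deltaSum {o : M} {w : M → ℂ} {f : M → M}
    (h : IsBoundedWeighted o w f) (a : M →₀ ℂ) :
    weightedLipschitz o w f (deltaSum o a) = weightedSum o w f a :=
  LinearMap.extendOfNorm_eq (denseRange_deltaSum o) h a

theorem weightedLipschitz_delta {o : M} {w : M → ℂ} {f : M → M}
    (h : IsBoundedWeighted o w f) (x : M) :
    weightedLipschitz o w f (delta o x) = w x • delta o (f x) := by
  have := weightedLipschitz_deltaSum h (Finsupp.single x 1)
  simpa [deltaSum, weightedSum] using this

end FreeSpace

section Dynamics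

variable {M : Type*}

/-- `f` is `(r, ε)`-flat. -/
def IsFlat [MetricSpace M] (f : M → M) (r ε : ℝ) : Prop :=
  ∀ x y : M, x ≠ y → dist x y ≤ r → dist (f x) (f y) / dist x y ≤ ε

/-- The set of periodic points of order `n` (that is, of minimal period `n ≥ 1`) of `f` which
differ from the base point. -/
def Per (o : M) (f : M → M) (n : ℕ) : Set M :=
  {x | x ≠ o ∧ 0 < n ∧ Function.minimalPeriod f x = n}

/-- The set of all `n` for which `f` has a periodic point of order `n` different from the base
point. -/
def perOrders (o : M) (f : M → M) : Set ℕ := {n | (Per o f n).Nonempty}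

theorem mem_Per_iff {o : M} {f : M → M} {n : ℕ} {x : M} :
    x ∈ Per o f n ↔ x ≠ o ∧ 1 ≤ n ∧ f^[n] x = x ∧ ∀ k, 1 ≤ k → k ≤ n - 1 → f^[k] x ≠ x := by
  constructor
  · rintro ⟨hx, hn, rfl⟩
    refine ⟨hx, hn, Function.iterate_minimalPeriod, fun k hk hkn hfk => ?_⟩
    have : Function.minimalPeriod f x ≤ k := Function.IsPeriodicPt.minimalPeriod_le hk hfk
    omega
  · rintro ⟨hx, hn, hp, hmin⟩
    refine ⟨hx, hn, le_antisymm (Function.IsPeriodicPt.minimalPeriod_le hn hp) ?_⟩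
    by_contra hlt
    have hpos : 0 < Function.minimalPeriod f x :=
      Function.IsPeriodicPt.minimalPeriod_pos hn hp
    exact hmin _ hpos (by omega) Function.iterate_minimalPeriod

end Dynamics

/-- The set of complex `n`-th roots of unity. -/
def unitRoots (n : ℕ) : Set ℂ := {z | z ^ n = 1}

/-- The point spectrum of a bounded operator: the set of its eigenvalues. -/
def pointSpectrum {E : Type*} [NormedAddCommGroup E] [NormedSpace ℂ E] (T : E →L[ℂ] E) : Set ℂ :=
  {l | Module.End.HasEigenvalue (T : Module.End ℂ E) l}

end LipFree

/-! Let `γ` be an eigenvector with eigenvalue `l ≠ 0`. If `γ` lies in `F_M(N)`, then `l • γ`, hence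
`γ`, lies in `F_M(f(N))`; so `γ ∈ F_M(f^n(K))` for all `n`, where `K` is the compact closure of
`f(M)`. These compact sets decrease, and `mem_freeOn_iInter` places `γ` over their intersection.
Flatness makes that intersection finite (`IsFlat.finite_iInter_image_iterate`): `f^n` shrinks each
of the finitely many small balls covering `K` to diameter at most `ε^n r`. Thus `γ` is a finite
combination of evaluations.

The rest is linear algebra. Comparing coefficients, `f` permutes the finite support and `l * a (f x)
= a x * w x` (`coeff_map_of_eigen`); going once around a cycle gives the product formula.
Conversely, solving this recursion along a cycle gives an eigenvector (`hasEigenvalue_of_mem_Per`).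
-/

open Filter Topology

namespace LipFree

/-! ### Lipschitz functions as the dual of the free space. -/

section Duality

variable {M : Type*} [MetricSpace M] {o : M}

theorem toDual_deltaSum (a : M →₀ ℂ) (g : Lip0 o) :
    FreeSpace.toDual o (deltaSum o a) g = a.sum fun x c => c * g x := by
  rw [deltaSum, Finsupp.linearCombination_apply, Finsupp.sum, Finsupp.sum, map_sum,
    sum_apply]
  refine Finset.sum_congr rfl fun x _ => ?_
  rw [map_smul, smul_apply, FreeSpace.toDual_delta, smul_eq_mul]

theorem deltaSum_single (x : M) (c : ℂ) :
    deltaSum o (Finsupp.single x c) = c • delta o x := by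
  simp [deltaSum]

theorem delta_base (o : M) : delta o o = 0 := by
  refine (FreeSpace.toDual o).injective ?_
  ext g
  rw [FreeSpace.toDual_delta, g.base, map_zero, zero_apply]

theorem norm_delta_sub_le (x y : M) : ‖delta o x - delta o y‖ ≤ dist x y := by
  rw [← (FreeSpace.toDual o).norm_map]
  refine ContinuousLinearMap.opNorm_le_bound _ dist_nonneg fun g => ?_
  rw [map_sub, sub_apply, FreeSpace.toDual_delta, FreeSpace.toDual_delta,
    mul_comm]
  exact g.norm_sub_le x y

/-- The pairing of `F(M)` with a Lipschitz function, as a functional on `F(M)`. -/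
noncomputable def pairing (g : Lip0 o) : StrongDual ℂ (FreeSpace o) :=
  (ContinuousLinearMap.apply ℂ ℂ g).comp (FreeSpace.toDual o).toContinuousLinearMap

theorem pairing_apply (g : Lip0 o) (γ : FreeSpace o) :
    pairing g γ = FreeSpace.toDual o γ g := rfl

theorem pairing_delta (g : Lip0 o) (x : M) : pairing g (delta o x) = g x := rfl

theorem norm_pairing_apply_le (g : Lip0 o) (γ : FreeSpace o) :
    ‖pairing g γ‖ ≤ ‖γ‖ * ‖g‖ := by
  rw [pairing_apply, ← (FreeSpace.toDual o).norm_map]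
  exact ContinuousLinearMap.le_opNorm _ _

/-- Every functional on `F(M)` is the pairing with a Lipschitz function. -/
theorem exists_pairing_eq (φ : StrongDual ℂ (FreeSpace o)) : ∃ g : Lip0 o, pairing g = φ := by
  refine ⟨⟨fun x => φ (delta o x), by simp only [delta_base, map_zero], ‖φ‖₊, ?_⟩, ?_⟩
  · refine LipschitzWith.of_dist_le_mul fun x y => ?_
    rw [dist_eq_norm, ← map_sub]
    exact (φ.le_opNorm _).trans
      (mul_le_mul_of_nonneg_left (norm_delta_sub_le x y) (norm_nonneg _))
  · refine ContinuousLinearMap.coeFn_injective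
      ((denseRange_deltaSum o).equalizer (ContinuousLinearMap.continuous _) φ.continuous ?_)
    funext a
    induction a using Finsupp.induction_linear with
    | zero => simp
    | add a b ha hb =>
      simp only [Function.comp_apply, map_add] at ha hb ⊢
      rw [ha, hb]
    | single x c =>
      simp only [Function.comp_apply, deltaSum_single, map_smul]
      rfl

theorem pairing_eq_zero_of_mem_freeOn {N : Set M} {γ : FreeSpace o} (hγ : γ ∈ freeOn o N)
    {g : Lip0 o} (hg : ∀ x ∈ N, g x = 0) : pairing g γ = 0 := by
  have h : freeOn o N ≤ (pairing g).ker := by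
    refine Submodule.topologicalClosure_minimal _ ?_ (pairing g).isClosed_ker
    rw [Submodule.span_le]
    rintro _ ⟨x, hx, rfl⟩
    exact hg x hx
  exact h hγ

/-- Hahn–Banach in the quotient by `freeOn o N`: a functional killing this subspace is the pairing
with some `g` that vanishes on `N`. -/
theorem mem_freeOn_of_pairing {N : Set M} {γ : FreeSpace o}
    (h : ∀ g : Lip0 o, (∀ x ∈ N, g x = 0) → pairing g γ = 0) : γ ∈ freeOn o N := by
  by_contra hγ
  have : IsClosed (freeOn o N : Set (FreeSpace o)) := Submodule.isClosed_topologicalClosure _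
  have hne : (freeOn o N).mkQ γ ≠ 0 := by
    rwa [Submodule.mkQ_apply, Ne, Submodule.Quotient.mk_eq_zero]
  obtain ⟨φ, hφ⟩ := SeparatingDual.exists_ne_zero (R := ℂ) hne
  obtain ⟨g, hg⟩ := exists_pairing_eq (φ.comp (freeOn o N).mkQL)
  refine hφ ?_
  have hγ0 := h g fun x hx => ?_
  · rw [hg] at hγ0
    exact hγ0
  · rw [← pairing_delta, hg]
    have : (freeOn o N).mkQ (delta o x) = 0 := by
      rw [Submodule.mkQ_apply, Submodule.Quotient.mk_eq_zero]
      exact Submodule.le_topologicalClosure _ (Submodule.subset_span ⟨x, hx, rfl⟩)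
    change φ ((freeOn o N).mkQ (delta o x)) = 0
    rw [this, map_zero]

/-- Split `γ` into a finite combination and a small remainder: uniform smallness of `g'` controls
the former, the bound `C` on its Lipschitz norm the latter. -/
theorem pairing_eq_zero_of_approx {γ : FreeSpace o} {g : Lip0 o} {C : ℝ}
    (h : ∀ η > 0, ∃ g' : Lip0 o, ‖g'‖ ≤ C ∧ (∀ x, ‖g' x‖ ≤ η) ∧ pairing g γ = pairing g' γ) :
    pairing g γ = 0 := by
  obtain ⟨g₁, hg₁, -⟩ := h 1 one_pos
  have hC : 0 ≤ C := (norm_nonneg _).trans hg₁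
  rw [← norm_le_zero_iff]
  refine le_of_forall_pos_le_add fun ε hε => ?_
  obtain ⟨a, ha⟩ := (denseRange_deltaSum o).exists_dist_lt γ
    (show 0 < ε / 2 / (C + 1) by positivity)
  rw [dist_eq_norm] at ha
  set A : ℝ := ∑ x ∈ a.support, ‖a x‖
  have hA : 0 ≤ A := Finset.sum_nonneg fun _ _ => norm_nonneg _
  -- The uniform bound depends on the coefficient mass `A`, so `g'` is chosen after `a`.
  obtain ⟨g', hg', hsmall, heq⟩ := h (ε / 2 / (A + 1)) (by positivity)
  have h1 : ‖pairing g' (γ - deltaSum o a)‖ ≤ ε / 2 := by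
    refine (norm_pairing_apply_le _ _).trans ?_
    calc _ ≤ ε / 2 / (C + 1) * (C + 1) := by gcongr; linarith
      _ = ε / 2 := by field_simp
  have h2 : ‖pairing g' (deltaSum o a)‖ ≤ ε / 2 := by
    rw [pairing_apply, toDual_deltaSum]
    calc _ ≤ ∑ x ∈ a.support, ‖a x * g' x‖ := norm_sum_le _ _
      _ ≤ ∑ x ∈ a.support, ‖a x‖ * (ε / 2 / (A + 1)) := by
        refine Finset.sum_le_sum fun x _ => ?_
        rw [norm_mul]
        exact mul_le_mul_of_nonneg_left (hsmall x) (norm_nonneg _)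
      _ = A * (ε / 2 / (A + 1)) := by rw [Finset.sum_mul]
      _ ≤ (A + 1) * (ε / 2 / (A + 1)) := by gcongr; linarith
      _ = ε / 2 := by field_simp
  rw [heq, ← sub_add_cancel γ (deltaSum o a), map_add]
  linarith [norm_add_le (pairing g' (γ - deltaSum o a)) (pairing g' (deltaSum o a))]

end Duality

/-! ### Truncation of Lipschitz functions and intersections of compact sets. -/

section Intersection

/-- The projection of `t` onto the interval `[-η, η]`. -/
def clamp (η t : ℝ) : ℝ := max (-η) (min η t)

theorem abs_clamp_sub_le (η s t : ℝ) : |clamp η s - clamp η t| ≤ |s - t| := by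
  have h := ((LipschitzWith.id (α := ℝ)).const_min η).const_max (-η)
  simpa [clamp, Real.dist_eq] using h.dist_le_mul s t

theorem abs_clamp_le {η : ℝ} (hη : 0 ≤ η) (t : ℝ) : |clamp η t| ≤ η :=
  abs_le.2 ⟨le_max_left _ _, max_le (by linarith) (min_le_left _ _)⟩

theorem clamp_of_abs_le {η t : ℝ} (h : |t| ≤ η) : clamp η t = t := by
  rw [clamp, min_eq_right (abs_le.1 h).2, max_eq_right (abs_le.1 h).1]

/-- The projection of `z` onto the square of side `2 * η` centred at `0`. -/
def squareClamp (η : ℝ) (z : ℂ) : ℂ := ⟨clamp η z.re, clamp η z.im⟩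

/-- The factor 2 is the price of bounding the modulus by the sum of the two coordinates; only its
independence of `η` matters. -/
theorem norm_squareClamp_sub_le (η : ℝ) (z z' : ℂ) :
    ‖squareClamp η z - squareClamp η z'‖ ≤ 2 * ‖z - z'‖ := by
  have h1 := abs_clamp_sub_le η z.re z'.re
  have h2 := abs_clamp_sub_le η z.im z'.im
  have h3 := Complex.abs_re_le_norm (z - z')
  have h4 := Complex.abs_im_le_norm (z - z')
  rw [Complex.sub_re] at h3
  rw [Complex.sub_im] at h4
  refine (Complex.norm_le_abs_re_add_abs_im _).trans ?_
  simp only [squareClamp, Complex.sub_re, Complex.sub_im]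
  linarith

theorem norm_squareClamp_le {η : ℝ} (hη : 0 ≤ η) (z : ℂ) : ‖squareClamp η z‖ ≤ 2 * η := by
  refine (Complex.norm_le_abs_re_add_abs_im _).trans ?_
  have h1 := abs_clamp_le hη z.re
  have h2 := abs_clamp_le hη z.im
  simp only [squareClamp]
  linarith

theorem squareClamp_of_norm_le {η : ℝ} {z : ℂ} (h : ‖z‖ ≤ η) : squareClamp η z = z :=
  Complex.ext (clamp_of_abs_le ((Complex.abs_re_le_norm z).trans h))
    (clamp_of_abs_le ((Complex.abs_im_le_norm z).trans h))

variable {M : Type*} [MetricSpace M] {o : M}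

theorem exists_lip0_squareClamp (g : Lip0 o) {η : ℝ} (hη : 0 ≤ η) :
    ∃ g' : Lip0 o, ‖g'‖ ≤ 2 * ‖g‖ ∧ ∀ x, g' x = squareClamp η (g x) := by
  have hdist : ∀ x y, ‖squareClamp η (g x) - squareClamp η (g y)‖ ≤ 2 * ‖g‖ * dist x y :=
    fun x y => (norm_squareClamp_sub_le _ _ _).trans
      (by rw [mul_assoc]; exact mul_le_mul_of_nonneg_left (g.norm_sub_le x y) zero_le_two)
  refine ⟨⟨fun x => squareClamp η (g x), ?_, 2 * ‖g‖₊, ?_⟩, ?_, fun _ => rfl⟩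
  · simp only [g.base]
    exact squareClamp_of_norm_le (by simpa using hη)
  · refine LipschitzWith.of_dist_le_mul fun x y => ?_
    rw [dist_eq_norm]
    exact hdist x y
  · exact Lip0.norm_le_of (by positivity) hdist

theorem Lip0.continuous (g : Lip0 o) : Continuous g :=
  g.2.2.choose_spec.continuous

/-- For a decreasing sequence of compact sets, the subspaces `F_M(K n)` intersect in the subspace
of the intersection. -/
theorem mem_freeOn_iInter {K : ℕ → Set M} (hanti : Antitone K) (hK : ∀ n, IsCompact (K n))
    {γ : FreeSpace o} (hγ : ∀ n, γ ∈ freeOn o (K n)) : γ ∈ freeOn o (⋂ n, K n) := by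
  refine mem_freeOn_of_pairing fun g hg => pairing_eq_zero_of_approx (C := 2 * ‖g‖) fun η hη => ?_
  obtain ⟨g', hnorm, hg'⟩ := exists_lip0_squareClamp g (half_pos hη).le
  refine ⟨g', hnorm, fun x => ?_, ?_⟩
  · rw [hg']
    linarith [norm_squareClamp_le (half_pos hη).le (g x)]
  · have hU : IsOpen {x | ‖g x‖ < η / 2} := isOpen_lt g.continuous.norm continuous_const
    -- By compactness some `K n` already lies where `g` is small, and there `g` coincides with its
    -- truncation.
    obtain ⟨n, hn⟩ := exists_subset_nhds_of_isCompact hanti.directed_ge hK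
      (U := {x | ‖g x‖ < η / 2}) fun x hx => hU.mem_nhds (by
        change ‖g x‖ < η / 2
        rw [hg x hx, norm_zero]
        exact half_pos hη)
    have h0 : pairing (g - g') γ = 0 := by
      refine pairing_eq_zero_of_mem_freeOn (hγ n) fun x hx => ?_
      change g x - g' x = 0
      rw [hg', squareClamp_of_norm_le (hn hx).le, sub_self]
    rw [pairing_apply, map_sub, sub_eq_zero] at h0
    exact h0

end Intersection

/-! ### Supports of finite combinations. -/

section Support

variable {M : Type*} [MetricSpace M] {o : M}

/-- If `x ∉ N`, the distance to `N`, the base point and the other points of `a` is a Lipschitz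
function that isolates the coefficient at `x`. -/
theorem mem_of_deltaSum_mem_freeOn {a : M →₀ ℂ} {N : Set M} (hN : IsClosed N)
    (h : deltaSum o a ∈ freeOn o N) {x : M} (hx : x ≠ o) (hax : a x ≠ 0) : x ∈ N := by
  classical
  by_contra hxN
  set D : Set M := N ∪ insert o (↑(a.support.erase x) : Set M)
  have hD : IsClosed D := hN.union ((Finset.finite_toSet _).insert o).isClosed
  have hoD : o ∈ D := Or.inr (Set.mem_insert _ _)
  have hxD : x ∉ D := by simp [D, hxN, hx]
  let g : Lip0 o := ⟨fun y => (Metric.infDist y D : ℂ), by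
      simp [Metric.infDist_zero_of_mem hoD], 1,
    (Complex.isometry_ofReal.lipschitz.comp (Metric.lipschitz_infDist_pt D)).weaken (by simp)⟩
  have hgD : ∀ y ∈ D, g y = 0 := fun y hy => by
    change ((Metric.infDist y D : ℝ) : ℂ) = 0
    rw [Metric.infDist_zero_of_mem hy, Complex.ofReal_zero]
  have hgx : g x ≠ 0 := Complex.ofReal_ne_zero.2
    ((hD.notMem_iff_infDist_pos ⟨o, hoD⟩).1 hxD).ne'
  have h0 := pairing_eq_zero_of_mem_freeOn h (g := g) fun y hy => hgD y (Or.inl hy)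
  rw [pairing_apply, toDual_deltaSum, Finsupp.sum,
    Finset.sum_eq_single_of_mem x (Finsupp.mem_support_iff.2 hax)] at h0
  · exact mul_ne_zero hax hgx h0
  · intro y hy hyx
    rw [hgD y (Or.inr (Or.inr (Finset.mem_erase.2 ⟨hyx, hy⟩))), mul_zero]

theorem apply_eq_zero_of_deltaSum_eq_zero {a : M →₀ ℂ} (h : deltaSum o a = 0) {x : M}
    (hx : x ≠ o) : a x = 0 := by
  by_contra hax
  exact mem_of_deltaSum_mem_freeOn (N := ∅) isClosed_empty (h ▸ Submodule.zero_mem _) hx hax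

theorem isSupport_deltaSum {a : M →₀ ℂ} (ha : a o = 0) :
    IsSupport o (deltaSum o a) a.support := by
  refine ⟨⟨a.support.finite_toSet.isClosed, ?_⟩, fun N hN x hx => ?_⟩
  · refine Submodule.le_topologicalClosure _ ?_
    rw [Finsupp.mem_span_image_iff_linearCombination]
    exact ⟨a, (Finsupp.mem_supported _ _).2 subset_rfl, rfl⟩
  · have hax : a x ≠ 0 := Finsupp.mem_support_iff.1 hx
    exact mem_of_deltaSum_mem_freeOn hN.1 hN.2 (fun hxo => hax (hxo ▸ ha)) hax

theorem exists_deltaSum_of_mem_freeOn {N : Set M} (hN : N.Finite) {γ : FreeSpace o}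
    (h : γ ∈ freeOn o N) : ∃ a : M →₀ ℂ, a o = 0 ∧ deltaSum o a = γ := by
  have : FiniteDimensional ℂ (Submodule.span ℂ (delta o '' N)) :=
    FiniteDimensional.span_of_finite ℂ (hN.image _)
  rw [freeOn, (Submodule.closed_of_finiteDimensional _).submodule_topologicalClosure_eq,
    Finsupp.mem_span_image_iff_linearCombination] at h
  obtain ⟨a, -, ha⟩ := h
  -- The coefficient at the base point can be discarded because `delta o o = 0`.
  refine ⟨a - Finsupp.single o (a o), by simp, ?_⟩
  rw [map_sub, deltaSum_single, delta_base, smul_zero, sub_zero]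
  exact ha

end Support

/-! ### Action of the operator on the subspaces `F_M(N)`. -/

section Operator

variable {M : Type*} [MetricSpace M] {o : M} {w : M → ℂ} {f : M → M}

theorem weightedLipschitz_mem_freeOn (h : IsBoundedWeighted o w f) {N : Set M}
    {γ : FreeSpace o} (hγ : γ ∈ freeOn o N) : weightedLipschitz o w f γ ∈ freeOn o (f '' N) := by
  have hle : freeOn o N ≤
      (freeOn o (f '' N)).comap (weightedLipschitz o w f : FreeSpace o →ₗ[ℂ] FreeSpace o) := by
    refine Submodule.topologicalClosure_minimal _ ?_
      ((Submodule.isClosed_topologicalClosure _).preimage (weightedLipschitz o w f).continuous)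
    rw [Submodule.span_le]
    rintro _ ⟨x, hx, rfl⟩
    change weightedLipschitz o w f (delta o x) ∈ freeOn o (f '' N)
    rw [weightedLipschitz_delta h]
    exact Submodule.smul_mem _ _ (Submodule.le_topologicalClosure _
      (Submodule.subset_span ⟨f x, ⟨x, hx, rfl⟩, rfl⟩))
  exact hle hγ

theorem freeOn_mono {N N' : Set M} (h : N ⊆ N') : freeOn o N ≤ freeOn o N' :=
  Submodule.topologicalClosure_mono (Submodule.span_mono (Set.image_mono h))

theorem mem_freeOn_univ (γ : FreeSpace o) : γ ∈ freeOn o Set.univ :=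
  mem_freeOn_of_pairing fun g hg => by
    have : g = 0 := Subtype.ext (funext fun x => hg x trivial)
    rw [this, pairing_apply, map_zero]

theorem mem_freeOn_image_of_eigen (h : IsBoundedWeighted o w f) {l : ℂ} (hl : l ≠ 0)
    {γ : FreeSpace o} (hγ : weightedLipschitz o w f γ = l • γ) {N : Set M}
    (hN : γ ∈ freeOn o N) : γ ∈ freeOn o (f '' N) := by
  have := weightedLipschitz_mem_freeOn h hN
  rw [hγ] at this
  exact (Submodule.smul_mem_iff _ hl).1 this

end Operator

/-! ### Contraction by the iterates of a flat map. -/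

section Flat

variable {M : Type*} [MetricSpace M] {f : M → M} {r ε : ℝ}

theorem IsFlat.dist_le (hf : IsFlat f r ε) {x y : M} (h : dist x y ≤ r) :
    dist (f x) (f y) ≤ ε * dist x y := by
  rcases eq_or_ne x y with rfl | hxy
  · simp
  · exact (div_le_iff₀ (dist_pos.2 hxy)).1 (hf x y hxy h)

theorem IsFlat.dist_iterate_le (hf : IsFlat f r ε) (hε0 : 0 ≤ ε) (hε1 : ε ≤ 1) {x y : M}
    (h : dist x y ≤ r) (n : ℕ) : dist (f^[n] x) (f^[n] y) ≤ ε ^ n * dist x y := by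
  induction n with
  | zero => simp
  | succ n ih =>
    have hle : dist (f^[n] x) (f^[n] y) ≤ r :=
      ih.trans ((mul_le_of_le_one_left dist_nonneg (pow_le_one₀ hε0 hε1)).trans h)
    rw [Function.iterate_succ_apply', Function.iterate_succ_apply', pow_succ', mul_assoc]
    exact (hf.dist_le hle).trans (mul_le_mul_of_nonneg_left ih hε0)

theorem IsFlat.continuous (hf : IsFlat f r ε) (hr : 0 < r) (hε : 0 < ε) : Continuous f := by
  refine Metric.continuous_iff.2 fun y η hη => ⟨min r (η / ε), by positivity, fun x hx => ?_⟩
  have h1 := hf.dist_le (hx.le.trans (min_le_left _ _))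
  have h2 : dist x y < η / ε := hx.trans_le (min_le_right _ _)
  rw [lt_div_iff₀ hε] at h2
  linarith

/-- Pigeonhole: given more points than covering balls, take `n` with `ε ^ n * r` below all their
mutual distances. Two of the points have `n`-th preimages in one ball, hence within `r`, which puts
the points too close together. -/
theorem IsFlat.finite_iInter_image_iterate (hf : IsFlat f r ε) (hr : 0 < r) (hε0 : 0 ≤ ε)
    (hε1 : ε < 1) {K : Set M} (hK : TotallyBounded K) : (⋂ n, f^[n] '' K).Finite := by
  obtain ⟨t, ht, hKt⟩ := Metric.totallyBounded_iff.1 hK (r / 2) (half_pos hr)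
  by_contra hinf
  obtain ⟨s, hs, hcard⟩ := Set.Infinite.exists_subset_card_eq hinf (ht.toFinset.card + 1)
  have hev : ∀ᶠ n : ℕ in atTop, ∀ p ∈ s, ∀ q ∈ s, p ≠ q → ε ^ n * r < dist p q := by
    refine (eventually_all_finset _).2 fun p _ => (eventually_all_finset _).2 fun q _ => ?_
    rcases eq_or_ne p q with rfl | hpq
    · exact Eventually.of_forall fun _ h => absurd rfl h
    · have hlim : Tendsto (fun n : ℕ => ε ^ n * r) atTop (𝓝 (0 * r)) :=
        (tendsto_pow_atTop_nhds_zero_of_lt_one hε0 hε1).mul_const r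
      rw [zero_mul] at hlim
      exact (hlim.eventually_lt_const (dist_pos.2 hpq)).mono fun _ h _ => h
  obtain ⟨n, hn⟩ := hev.exists
  have hex : ∀ p, ∃ c, p ∈ s → c ∈ t ∧ ∃ q, dist q c < r / 2 ∧ f^[n] q = p := by
    intro p
    by_cases hp : p ∈ s
    · obtain ⟨q, hq, rfl⟩ := Set.mem_iInter.1 (hs hp) n
      obtain ⟨c, hc, hqc⟩ := Set.mem_iUnion₂.1 (hKt hq)
      exact ⟨c, fun _ => ⟨hc, q, hqc, rfl⟩⟩
    -- A default value outside `s`, never used.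
    · exact ⟨p, fun h => absurd h hp⟩
  choose c hc using hex
  obtain ⟨p, hp, p', hp', hne, heq⟩ := Finset.exists_ne_map_eq_of_card_lt_of_maps_to
    (s := s) (t := ht.toFinset) (f := c) (by omega) fun p hp => ht.mem_toFinset.2 (hc p hp).1
  obtain ⟨q, hq, hqp⟩ := (hc p hp).2
  obtain ⟨q', hq', hqp'⟩ := (hc p' hp').2
  rw [← heq] at hq'
  have hqq : dist q q' ≤ r := by linarith [dist_triangle_right q q' (c p)]
  have h1 := hf.dist_iterate_le hε0 hε1.le hqq n
  rw [hqp, hqp'] at h1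
  have h2 : ε ^ n * dist q q' ≤ ε ^ n * r := mul_le_mul_of_nonneg_left hqq (pow_nonneg hε0 n)
  linarith [hn p hp p' hp' hne]

end Flat

/-! ### Eigenvectors and periodic orbits. -/

section Eigenvectors

variable {M : Type*} [MetricSpace M] {o : M} {w : M → ℂ} {f : M → M}

theorem exists_deltaSum_of_eigen [CompleteSpace M] (h : IsBoundedWeighted o w f)
    (hM : TotallyBounded (Set.range f)) {r ε : ℝ} (hr : 0 < r) (hε0 : 0 < ε) (hε1 : ε < 1)
    (hf : IsFlat f r ε) {l : ℂ} (hl : l ≠ 0) {γ : FreeSpace o}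
    (hγ : weightedLipschitz o w f γ = l • γ) : ∃ a : M →₀ ℂ, a o = 0 ∧ deltaSum o a = γ := by
  have hfc : Continuous f := hf.continuous hr hε0
  set K : Set M := closure (Set.range f)
  have hK : IsCompact K := hM.closure.isCompact_of_isClosed isClosed_closure
  refine exists_deltaSum_of_mem_freeOn (hf.finite_iInter_image_iterate hr hε0.le hε1 hM.closure)
    (mem_freeOn_iInter (antitone_nat_of_succ_le fun n => ?_)
      (fun n => hK.image (hfc.iterate n)) fun n => ?_)
  · rw [Function.iterate_succ, Set.image_comp]
    refine Set.image_mono ?_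
    rintro _ ⟨x, -, rfl⟩
    exact subset_closure ⟨x, rfl⟩
  · induction n with
    | zero =>
      have := mem_freeOn_image_of_eigen h hl hγ (mem_freeOn_univ γ)
      rw [Set.image_univ] at this
      simpa using freeOn_mono subset_closure this
    | succ n ih =>
      rw [Function.iterate_succ', Set.image_comp]
      exact mem_freeOn_image_of_eigen h hl hγ ih

theorem weightedSum_eq_deltaSum (a : M →₀ ℂ) :
    weightedSum o w f a = deltaSum o (a.sum fun x c => Finsupp.single (f x) (c * w x)) := by
  rw [weightedSum, Finsupp.linearCombination_apply, Finsupp.sum, Finsupp.sum, map_sum]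
  exact Finset.sum_congr rfl fun x _ => by rw [deltaSum_single, smul_smul]

open Classical in
theorem coeff_of_eigen (h : IsBoundedWeighted o w f) {l : ℂ} {a : M →₀ ℂ}
    (ha : weightedLipschitz o w f (deltaSum o a) = l • deltaSum o a) {y : M} (hy : y ≠ o) :
    l * a y = ∑ x ∈ a.support, if f x = y then a x * w x else 0 := by
  rw [weightedLipschitz_deltaSum h, weightedSum_eq_deltaSum, ← map_smul, ← sub_eq_zero,
    ← map_sub] at ha
  have := apply_eq_zero_of_deltaSum_eq_zero ha hy
  rw [Finsupp.sub_apply, Finsupp.smul_apply, sub_eq_zero, smul_eq_mul, Finsupp.sum_apply] at this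
  rw [← this, Finsupp.sum]
  exact Finset.sum_congr rfl fun x _ => Finsupp.single_apply

/-- On the support of a finitely supported eigenvector, the map is a permutation and transports
the coefficients. -/
theorem coeff_map_of_eigen (h : IsBoundedWeighted o w f) {l : ℂ} (hl : l ≠ 0) {a : M →₀ ℂ}
    (hao : a o = 0) (ha : weightedLipschitz o w f (deltaSum o a) = l • deltaSum o a) :
    Set.InjOn f a.support ∧
      ∀ x ∈ a.support, f x ∈ a.support ∧ l * a (f x) = a x * w x := by
  classical
  have hne : ∀ x ∈ a.support, x ≠ o := fun x hx hxo =>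
    Finsupp.mem_support_iff.1 hx (hxo ▸ hao)
  have hsub : a.support ⊆ a.support.image f := by
    intro y hy
    have hs := coeff_of_eigen h ha (hne y hy)
    have h0 : l * a y ≠ 0 := mul_ne_zero hl (Finsupp.mem_support_iff.1 hy)
    rw [hs] at h0
    obtain ⟨x, hx, hx0⟩ := Finset.exists_ne_zero_of_sum_ne_zero h0
    have hfx : f x = y := by
      by_contra hfx
      exact hx0 (if_neg hfx)
    exact Finset.mem_image.2 ⟨x, hx, hfx⟩
  -- A finite set contained in its own image equals it, and `f` is then injective on it.
  have himg : a.support = a.support.image f :=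
    Finset.eq_of_subset_of_card_le hsub Finset.card_image_le
  have hinj : Set.InjOn f a.support := Finset.card_image_iff.1 (by rw [← himg])
  refine ⟨hinj, fun x hx => ?_⟩
  have hfx : f x ∈ a.support := by
    rw [himg]
    exact Finset.mem_image_of_mem f hx
  refine ⟨hfx, ?_⟩
  rw [coeff_of_eigen h ha (hne _ hfx), Finset.sum_eq_single_of_mem x hx, if_pos rfl]
  intro z hz hzx
  exact if_neg fun hfz => hzx (hinj hz hx hfz)

/-- The factors at `0` and `n` agree, so shifting the index by one around the cycle changes nothing.
-/
theorem prod_Icc_iterate_eq_prod_range {M : Type*} {w : M → ℂ} {f : M → M} {n : ℕ} {x : M}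
    (hx : f^[n] x = x) :
    ∏ i ∈ Finset.Icc 1 n, w (f^[i] x) = ∏ i ∈ Finset.range n, w (f^[i] x) := by
  rw [← Finset.Ico_add_one_right_eq_Icc, Finset.prod_Ico_eq_prod_range]
  rcases n with _ | n
  · simp
  · rw [Nat.add_sub_cancel, Finset.prod_range_succ, Finset.prod_range_succ', Nat.add_comm 1 n, hx]
    simp [Nat.add_comm]

theorem exists_mem_Per_of_eigen (h : IsBoundedWeighted o w f) {l : ℂ} (hl : l ≠ 0) {a : M →₀ ℂ}
    (hao : a o = 0) (ha0 : a ≠ 0)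
    (ha : weightedLipschitz o w f (deltaSum o a) = l • deltaSum o a) :
    ∃ n, ∃ x ∈ Per o f n, l ^ n = ∏ i ∈ Finset.Icc 1 n, w (f^[i] x) := by
  obtain ⟨hinj, hmap⟩ := coeff_map_of_eigen h hl hao ha
  obtain ⟨x, hx⟩ := Finsupp.support_nonempty_iff.2 ha0
  have hmaps : Set.MapsTo f a.support a.support := fun y hy => (hmap y hy).1
  have hmem : ∀ k, f^[k] x ∈ a.support := fun k => hmaps.iterate k hx
  -- The coefficient recursion telescoped along the orbit; at the minimal period, `a x` cancels.
  have hcoeff : ∀ k, l ^ k * a (f^[k] x) = a x * ∏ i ∈ Finset.range k, w (f^[i] x) := by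
    intro k
    induction k with
    | zero => simp
    | succ k ih =>
      rw [Finset.prod_range_succ, ← mul_assoc, ← ih, Function.iterate_succ_apply', pow_succ,
        mul_assoc, (hmap _ (hmem k)).2, mul_assoc]
  have hper : 0 < Function.minimalPeriod f x := by
    refine Function.minimalPeriod_pos_of_mem_periodicPts ?_
    obtain ⟨i, j, hij, heq⟩ : ∃ i j, i < j ∧ f^[i] x = f^[j] x := by
      have : ¬ Function.Injective fun k => (⟨f^[k] x, hmem k⟩ : a.support) :=
        not_injective_infinite_finite _
      simp only [Function.Injective, not_forall] at this
      obtain ⟨i, j, heq, hne⟩ := this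
      have heq' : f^[i] x = f^[j] x := congrArg Subtype.val heq
      rcases lt_or_gt_of_ne hne with hlt | hlt
      · exact ⟨i, j, hlt, heq'⟩
      · exact ⟨j, i, hlt, heq'.symm⟩
    refine ⟨j - i, Nat.sub_pos_of_lt hij, ?_⟩
    -- Injectivity on the support cancels `f^[i]`, so the orbit is periodic from `x` itself, not
    -- just eventually.
    refine (hinj.iterate hmaps i) (hmem _) hx ?_
    rw [← Function.iterate_add_apply, Nat.add_sub_cancel' hij.le, heq]
  have hxx : f^[Function.minimalPeriod f x] x = x := Function.iterate_minimalPeriod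
  have hax : a x ≠ 0 := Finsupp.mem_support_iff.1 hx
  refine ⟨_, x, ⟨fun hxo => hax (hxo ▸ hao), hper, rfl⟩, ?_⟩
  rw [prod_Icc_iterate_eq_prod_range hxx]
  have := hcoeff (Function.minimalPeriod f x)
  rw [hxx, mul_comm] at this
  exact mul_left_cancel₀ hax this

/-- The eigenvector is `∑ c k • δ(f^k x)` over one period, with `c` solving `l * c (k + 1) = c k * w
(f^k x)` from `c 0 = 1`; the product condition says exactly that `c n = 1`, so the cycle closes up.
-/
theorem hasEigenvalue_of_mem_Per (h : IsBoundedWeighted o w f) {l : ℂ} (hl : l ≠ 0) {n : ℕ}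
    {x : M} (hx : x ∈ Per o f n) (hprod : l ^ n = ∏ i ∈ Finset.Icc 1 n, w (f^[i] x)) :
    Module.End.HasEigenvalue (weightedLipschitz o w f : Module.End ℂ (FreeSpace o)) l := by
  obtain ⟨hxo, hn, hmin⟩ := hx
  have hxx : f^[n] x = x := hmin ▸ Function.iterate_minimalPeriod
  rw [prod_Icc_iterate_eq_prod_range hxx] at hprod
  set c : ℕ → ℂ := fun k => (l ^ k)⁻¹ * ∏ i ∈ Finset.range k, w (f^[i] x) with hc
  have hc0 : c 0 = 1 := by simp [hc]
  have hcn : c n = 1 := by rw [hc]; simp only; rw [← hprod, inv_mul_cancel₀ (pow_ne_zero n hl)]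
  have hstep : ∀ k, c k * w (f^[k] x) = l * c (k + 1) := by
    intro k
    simp only [hc, Finset.prod_range_succ, pow_succ]
    field_simp
  set a : M →₀ ℂ := ∑ k ∈ Finset.range n, Finsupp.single (f^[k] x) (c k) with ha
  have hsum : deltaSum o a = ∑ k ∈ Finset.range n, c k • delta o (f^[k] x) := by
    rw [ha, map_sum]
    exact Finset.sum_congr rfl fun k _ => deltaSum_single _ _
  -- Minimality of the period leaves only `k = 0` contributing at `x`; this makes the vector
  -- nonzero.
  have hax : a x = 1 := by
    rw [ha, Finsupp.finsetSum_apply, Finset.sum_eq_single_of_mem 0 (Finset.mem_range.2 hn)]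
    · simp [hc0]
    · intro k hk hk0
      refine Finsupp.single_eq_of_ne fun hkx => ?_
      have : n ≤ k := hmin ▸
        Function.IsPeriodicPt.minimalPeriod_le (Nat.pos_of_ne_zero hk0) hkx.symm
      exact absurd (Finset.mem_range.1 hk) (not_lt.2 this)
  refine Module.End.hasEigenvalue_of_hasEigenvector (x := deltaSum o a)
    (Module.End.hasEigenvector_iff.2 ⟨Module.End.mem_eigenspace_iff.2 ?_, fun h0 => ?_⟩)
  · change weightedLipschitz o w f (deltaSum o a) = l • deltaSum o a
    rw [hsum, map_sum, Finset.smul_sum]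
    have hterm : ∀ k, weightedLipschitz o w f (c k • delta o (f^[k] x))
        = l • c (k + 1) • delta o (f^[k + 1] x) := fun k => by
      rw [map_smul, weightedLipschitz_delta h, smul_smul, hstep, Function.iterate_succ_apply',
        smul_smul]
    simp only [hterm]
    -- Peel the sum over `range (n + 1)` at either end: the removed terms agree because `c 0 = c n`
    -- and `f^n x = x`.
    have h1 := Finset.sum_range_succ (fun k => l • c k • delta o (f^[k] x)) n
    rw [Finset.sum_range_succ'] at h1
    simp only [hc0, hcn, hxx, Function.iterate_zero, id_eq] at h1
    exact add_right_cancel h1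
  · have := apply_eq_zero_of_deltaSum_eq_zero h0 hxo
    rw [hax] at this
    exact one_ne_zero this

theorem pointSpectrum_diff_zero [CompleteSpace M] (h : IsBoundedWeighted o w f)
    (hM : TotallyBounded (Set.range f)) {r ε : ℝ} (hr : 0 < r) (hε0 : 0 < ε) (hε1 : ε < 1)
    (hf : IsFlat f r ε) :
    pointSpectrum (weightedLipschitz o w f) \ {0} =
      ⋃ n ∈ perOrders o f,
        {l : ℂ | l ≠ 0 ∧ ∃ x ∈ Per o f n, l ^ n = ∏ i ∈ Finset.Icc 1 n, w (f^[i] x)} := by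
  ext l
  simp only [Set.mem_sdiff, Set.mem_singleton_iff, Set.mem_iUnion, Set.mem_ofPred_eq, exists_prop]
  constructor
  · rintro ⟨hev, hl⟩
    obtain ⟨γ, hγ⟩ := Module.End.HasEigenvalue.exists_hasEigenvector hev
    obtain ⟨a, hao, rfl⟩ := exists_deltaSum_of_eigen h hM hr hε0 hε1 hf hl hγ.apply_eq_smul
    obtain ⟨n, x, hx, hprod⟩ := exists_mem_Per_of_eigen h hl hao
      (fun ha => hγ.2 (by rw [ha, map_zero])) hγ.apply_eq_smul
    exact ⟨n, ⟨x, hx⟩, hl, x, hx, hprod⟩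
  · rintro ⟨n, -, hl, x, hx, hprod⟩
    exact ⟨hasEigenvalue_of_mem_Per h hl hx hprod, hl⟩

end Eigenvectors

end LipFree

theorem mainTheorem2 {M : Type*} [MetricSpace M] [CompleteSpace M] (o : M)
    (w : M → ℂ) (f : M → M) (hwf : LipFree.IsBoundedWeighted o w f)
    (hM : TotallyBounded (Set.range f))
    (r ε : ℝ) (hr : 0 < r) (hε0 : 0 < ε) (hε1 : ε < 1) (hf : LipFree.IsFlat f r ε) :
    (∀ (l : ℂ) (γ : LipFree.FreeSpace o), l ≠ 0 →
        Module.End.HasEigenvector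
          (LipFree.weightedLipschitz o w f : Module.End ℂ (LipFree.FreeSpace o)) l γ →
        ∃ S : Set M, LipFree.IsSupport o γ S ∧ S.Finite) ∧
      LipFree.pointSpectrum (LipFree.weightedLipschitz o w f) \ {0} =
        ⋃ n ∈ LipFree.perOrders o f,
          {l : ℂ | l ≠ 0 ∧ ∃ x ∈ LipFree.Per o f n,
            l ^ n = ∏ i ∈ Finset.Icc 1 n, w (f^[i] x)} ∧
      ((∀ x, w x = 1) →
        LipFree.pointSpectrum (LipFree.weightedLipschitz o w f) \ {0} =
          ⋃ n ∈ LipFree.perOrders o f, LipFree.unitRoots n) := by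
  have hspec := LipFree.pointSpectrum_diff_zero hwf hM hr hε0 hε1 hf
  refine ⟨fun l γ hl hγ => ?_, hspec, fun hw => ?_⟩
  · obtain ⟨a, hao, rfl⟩ :=
      LipFree.exists_deltaSum_of_eigen hwf hM hr hε0 hε1 hf hl hγ.apply_eq_smul
    exact ⟨a.support, LipFree.isSupport_deltaSum hao, a.support.finite_toSet⟩
  · rw [hspec]
    refine Set.iUnion₂_congr fun n hn => ?_
    obtain ⟨x, hx⟩ := hn
    ext l
    simp only [hw, Finset.prod_const_one, LipFree.unitRoots, Set.mem_ofPred_eq]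
    refine ⟨fun h => h.2.choose_spec.2, fun h => ⟨fun hl => ?_, x, hx, h⟩⟩
    -- Roots of unity are nonzero because the period is positive.
    rw [hl, zero_pow hx.2.1.ne'] at h
    exact zero_ne_one h
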